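/- **Theorem (Decay of Hardy weights).** Let $X$ be a countably infinite set, and let $b\colon X\times X\to[0,\infty)$ be a weighted graph: $b$ is symmetric, vanishes on the diagonal, and $\sum_{y\in X} b(x,y)<\infty$ for all $x\in X$. Write $x\sim y$ if $b(x,y)>0$. A set $V\subseteq X$ is connected if any two of its points are joined by a finite path $x_0\sim x_1\sim\dots\sim x_n$ in $V$; assume that $X$ is connected. Let $p\in(1,\infty)$, $c\colon X\to\mathbb R$, let $V\subseteq X$ be connected and non-empty, and let $m\colon X\to\mathbb R$ with $m>0$ on $V$. *Notation.* For $U\subseteq X$, $C(U)$ is the space of real functions on $U$, extended by zero to $X$, and $C_c(U)$ is its subspace of finitely supported functions. For $\phi\in C_c(X)$ put $$h(\phi)=\tfrac12\sum_{x,y\in X}b(x,y)|\phi(x)-\phi(y)|^p+\sum_{x\in X}c(x)|\phi(x)|^p .$$ A *Hardy weight* on $U$ is a function $w$ with $w\ge 0$ on $U$, $w\not\equiv 0$ on $U$, and $h(\phi)\ge\sum_{x} |\phi(x)|^pw(x)$ for all $\phi\in C_c(U)$. If $h\ge 0$ on $C_c(V)$, then $h$ is *subcritical* in $V$ if there is a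 Hardy weight on $V$, and *critical* in $V$ otherwise. For $U\subseteq X$, $q\ge1$ and $g\ge 0$ on $U$, $\ell^q(U,g)$ is the set of functions $f$ with $\sum_{x\in U}|f(x)|^qg(x)<\infty$. Put $\deg_W(x)=\sum_{y\in W}b(x,y)$. For $U\subseteq X$ let $F(U)$ be the set of $f\colon X\to\mathbb R$ with $\sum_y b(x,y)|f(x)-f(y)|^{p-1}<\infty$ for all $x\in U$. With $a^{\langle p-1\rangle}=|a|^{p-1}\operatorname{sgn}(a)$ and $U\subseteq V$, a function $f\in F(U)$ is *harmonic* (*superharmonic*) on $U$ if for all $x\in U$ $$Hf(x)=\frac1{m(x)}\sum_{y\in X}b(x,y)(f(x)-f(y))^{\langle p-1\rangle}+\frac{c(x)}{m(x)}f(x)^{\langle p-1\rangle}$$ is $=0$ (respectively $\ge0$). Call $f\colon X\to\mathbb R$ *strictly positive* if $f\ge0$ on $X$ and $f>0$ on $V$. For finite $K\subseteq V$, let $\mathcal M(V\setminus K)$ be the set of strictly positive $u\in F(V\setminus K)$ that are harmonic on $V\setminus K$ and have minimal growth: for every finite, connected, non-empty $\tilde K$ with $K\subseteq\tilde K\subseteq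 V$ and every strictly positive $v\in F(V\setminus\tilde K)$ that is superharmonic on $V\setminus\tilde K$, if $u\le v$ on $\tilde K$, then $u\le v$ on $V\setminus\tilde K$. An *Agmon ground state* in $V$ is an element $u\in\mathcal M(V)\cap C(V)$, where $\mathcal M(V)=\mathcal M(V\setminus\emptyset)$. *Statement.* Suppose $h\ge 0$ on $C_c(V)$. Let $W\subseteq V$ be non-empty, and let $K\subseteq V$ be finite and non-empty. (a) Let $h$ be critical in $V$ with an Agmon ground state $u\in\ell^p(V\setminus W,\deg_W)$ such that $\sup\{u(x)/u(y): x\in W,\ y\in V\setminus W,\ x\sim y\}<\infty$. Then every Hardy weight $w$ on $V\setminus W$ satisfies $w\in\ell^1(V\setminus W,u^p)$, that is, $u\in\ell^p(V\setminus W,w)$. (b) Let $h$ be subcritical in $V$, let there be only finitely many edges between $K$ and $V\setminus K$, and let $v\in\mathcal M(V\setminus K)$. Then every Hardy weight $w$ on $V$ satisfies $w\in\ell^1(V,v^p)$. -/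

import Mathlib

/-- A weighted graph `b` on `X`: symmetric, non-negative, zero diagonal, locally summable. -/
structure WeightedGraph (X : Type*) where
  b : X → X → ℝ
  nonneg : ∀ x y, 0 ≤ b x y
  symm : ∀ x y, b x y = b y x
  diag : ∀ x, b x x = 0
  summable : ∀ x, Summable (fun y => b x y)

namespace WeightedGraph

variable {X : Type*}

/-- Two vertices are neighbours if their edge weight is positive. -/
def Adj (G : WeightedGraph X) (x y : X) : Prop := 0 < G.b x y

/-- `V` is connected: any two of its vertices are joined by a finite path inside `V`. -/
def ConnectedOn (G : WeightedGraph X) (V : Set X) : Prop :=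
  ∀ x ∈ V, ∀ y ∈ V, Relation.ReflTransGen (fun a a' => a ∈ V ∧ a' ∈ V ∧ G.Adj a a') x y

/-- The partial degree `deg_W(x) = ∑_{y ∈ W} b(x,y)`. -/
noncomputable def degOn (G : WeightedGraph X) (W : Set X) (x : X) : ℝ := ∑' y : W, G.b x y

/-- `φ ∈ C_c(V)`: a function on `X` with finite support contained in `V`. -/
def IsCc (V : Set X) (φ : X → ℝ) : Prop := φ.support.Finite ∧ φ.support ⊆ V

/-- The odd power `|a|^{p-1} sgn(a)`. -/
noncomputable def signedPow (p a : ℝ) : ℝ := |a| ^ (p - 1) * Real.sign a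

/-- The formal space `F(V)`. -/
def formalSpace (G : WeightedGraph X) (p : ℝ) (V : Set X) : Set (X → ℝ) :=
  {f | ∀ x ∈ V, Summable (fun y => G.b x y * |f x - f y| ^ (p - 1))}

/-- The `p`-Laplacian with vertex weight `m`. -/
noncomputable def laplacian (G : WeightedGraph X) (p : ℝ) (m f : X → ℝ) (x : X) : ℝ :=
  (1 / m x) * ∑' y, G.b x y * signedPow p (f x - f y)

/-- The `p`-Schrödinger operator with potential `c` and vertex weight `m`. -/
noncomputable def schrodinger (G : WeightedGraph X) (p : ℝ) (c m f : X → ℝ) (x : X) : ℝ :=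
  G.laplacian p m f x + c x / m x * signedPow p (f x)

/-- `u ∈ F(V)` and `H u = 0` on `V`. -/
def IsHarmonicOn (G : WeightedGraph X) (p : ℝ) (c m : X → ℝ) (V : Set X) (u : X → ℝ) : Prop :=
  u ∈ G.formalSpace p V ∧ ∀ x ∈ V, G.schrodinger p c m u x = 0

/-- `u ∈ F(V)` and `H u ≥ 0` on `V`. -/
def IsSuperharmonicOn (G : WeightedGraph X) (p : ℝ) (c m : X → ℝ) (V : Set X)
    (u : X → ℝ) : Prop :=
  u ∈ G.formalSpace p V ∧ ∀ x ∈ V, 0 ≤ G.schrodinger p c m u x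

/-- Strict positivity relative to `V`, for functions defined on all of `X`: functions on `V` are
extended by zero, so off `V` only non-negativity is required. -/
def IsStrictlyPos (V : Set X) (u : X → ℝ) : Prop := (∀ x, 0 ≤ u x) ∧ ∀ x ∈ V, 0 < u x

/-- The set `M(V \ K)` of strictly positive functions that are harmonic on `V \ K` and have minimal
growth there. The comparison sets `K'` are non-empty: this is only a restriction for `K = ∅`, where
comparing on the empty set would be meaningless, as superharmonicity is invariant under scaling. -/
def minimalGrowth (G : WeightedGraph X) (p : ℝ) (c m : X → ℝ) (V K : Set X) : Set (X → ℝ) :=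
  {u | IsStrictlyPos V u ∧ G.IsHarmonicOn p c m (V \ K) u ∧
    ∀ K' : Set X, K'.Finite → K'.Nonempty → G.ConnectedOn K' → K' ⊆ V → K ⊆ K' →
      ∀ v : X → ℝ, IsStrictlyPos V v → G.IsSuperharmonicOn p c m (V \ K') v →
        (∀ x ∈ K', u x ≤ v x) → ∀ x ∈ V \ K', u x ≤ v x}

/-- The Agmon ground state on `V`: an element of `M(V) = M(V \ ∅)`, in `C(V)`, that is, extended by
zero off `V`. -/
def IsAgmonGroundState (G : WeightedGraph X) (p : ℝ) (c m : X → ℝ) (V : Set X)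
    (u : X → ℝ) : Prop :=
  u ∈ G.minimalGrowth p c m V ∅ ∧ ∀ x ∉ V, u x = 0

/-- The `p`-energy functional (used on finitely supported functions, where both sums converge). -/
noncomputable def energy (G : WeightedGraph X) (p : ℝ) (c φ : X → ℝ) : ℝ :=
  1 / 2 * ∑' z : X × X, G.b z.1 z.2 * |φ z.1 - φ z.2| ^ p + ∑' x, c x * |φ x| ^ p

/-- The functional `w_p(φ) = ∑ |φ|^p w` (used on finitely supported functions). -/
noncomputable def weightFunctional (p : ℝ) (w φ : X → ℝ) : ℝ := ∑' x, |φ x| ^ p * w x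

/-- `h ≥ 0` on `C_c(V)`. -/
def EnergyNonneg (G : WeightedGraph X) (p : ℝ) (c : X → ℝ) (V : Set X) : Prop :=
  ∀ φ : X → ℝ, IsCc V φ → 0 ≤ G.energy p c φ

/-- `w` is a Hardy weight on `V`: non-negative and not identically zero on `V`, with
`h ≥ w_p` on `C_c(V)`. -/
def IsHardyWeight (G : WeightedGraph X) (p : ℝ) (c : X → ℝ) (V : Set X) (w : X → ℝ) : Prop :=
  (∀ x ∈ V, 0 ≤ w x) ∧ (∃ x ∈ V, w x ≠ 0) ∧
    ∀ φ : X → ℝ, IsCc V φ → weightFunctional p w φ ≤ G.energy p c φ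

/-- `h` is subcritical in `V`. -/
def IsSubcritical (G : WeightedGraph X) (p : ℝ) (c : X → ℝ) (V : Set X) : Prop :=
  G.EnergyNonneg p c V ∧ ∃ w : X → ℝ, G.IsHardyWeight p c V w

/-- `h` is critical in `V`. -/
def IsCritical (G : WeightedGraph X) (p : ℝ) (c : X → ℝ) (V : Set X) : Prop :=
  G.EnergyNonneg p c V ∧ ¬ ∃ w : X → ℝ, G.IsHardyWeight p c V w

/-- `ℓ^q(V, w)` for a weight `w` that is non-negative on `V`. -/
def weightedLp (q : ℝ) (V : Set X) (w : X → ℝ) : Set (X → ℝ) :=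
  {f | Summable (fun x : V => |f x| ^ q * w x)}

end WeightedGraph

open Filter Topology

namespace WeightedGraph

variable {X : Type*}

/-! A function `u` of minimal growth is the limit on `V` of finitely supported functions `0 ≤ φ ≤ u`
of bounded energy. For a Hardy weight `w` on `V` this gives `∑ φ^p w ≤ h(φ) ≤ B`, and Fatou's lemma
yields `∑ u^p w ≤ B`, which is (b).

To find `φ`, fix a finite connected `K' ⊇ K` and minimise the energy among functions that equal `u`
on `K'`, vanish outside a finite set, and lie between `0` and `u` elsewhere. The bound `B` is the
energy of `1_{K'} u`, always a competitor. Minimisers are supersolutions on the finite set off `K'`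
(`schrodingerForm_nonneg_of_minimizer`), and so is a limit `f ≤ u` on `V \ K'`. The minimum
principle makes `f` positive on `V`, so minimal growth of `u` forces `u ≤ f`, hence `f = u` on `V`.

For (a), cut `φ` into its parts on `W` and on `V \ W`. The former has non-negative energy, and the
edges between them cost at most a multiple of `∑ u^p deg_W` (`energy_indicator_diff_le`). -/

/-! ### Odd powers and elementary inequalities -/

theorem signedPow_eq {p : ℝ} (a : ℝ) : signedPow p a = |a| ^ (p - 2) * a := by
  rcases eq_or_ne a 0 with rfl | ha
  · simp [signedPow]
  · have h : |a| ^ (p - 1) = |a| ^ (p - 2) * |a| := by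
      rw [← Real.rpow_add_one (abs_pos.2 ha).ne']; congr 1; ring
    rw [signedPow, h, mul_assoc]
    congr 1
    rcases lt_or_gt_of_ne ha with h | h
    · rw [Real.sign_of_neg h, abs_of_neg h]; ring
    · rw [Real.sign_of_pos h, abs_of_pos h]; ring

theorem signedPow_of_nonneg {p a : ℝ} (hp : 1 < p) (ha : 0 ≤ a) :
    signedPow p a = a ^ (p - 1) := by
  rcases ha.eq_or_lt with rfl | h
  · simp [signedPow, Real.zero_rpow (sub_pos.2 hp).ne']
  · rw [signedPow, Real.sign_of_pos h, abs_of_pos h, mul_one]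

theorem signedPow_neg {p a : ℝ} : signedPow p (-a) = -signedPow p a := by
  simp [signedPow, Real.sign_neg]

theorem abs_signedPow {p a : ℝ} (hp : 1 < p) : |signedPow p a| = |a| ^ (p - 1) := by
  rcases le_total 0 a with h | h
  · rw [signedPow_of_nonneg hp h, abs_of_nonneg h, abs_of_nonneg (Real.rpow_nonneg h _)]
  · rw [← neg_neg a, signedPow_neg, signedPow_of_nonneg hp (neg_nonneg.2 h), abs_neg, abs_neg,
      abs_of_nonneg (neg_nonneg.2 h), abs_of_nonneg (Real.rpow_nonneg (neg_nonneg.2 h) _)]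

theorem signedPow_mono {p : ℝ} (hp : 1 < p) : Monotone (signedPow p) := by
  have hq : 0 ≤ p - 1 := (sub_pos.2 hp).le
  intro a b hab
  rcases le_total 0 a with ha | ha
  · rw [signedPow_of_nonneg hp ha, signedPow_of_nonneg hp (ha.trans hab)]
    exact Real.rpow_le_rpow ha hab hq
  · have e : signedPow p a = -(-a) ^ (p - 1) := by
      rw [← signedPow_of_nonneg hp (neg_nonneg.2 ha), signedPow_neg, neg_neg]
    rcases le_total 0 b with hb | hb
    · rw [e, signedPow_of_nonneg hp hb]
      have := Real.rpow_nonneg (neg_nonneg.2 ha) (p - 1)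
      have := Real.rpow_nonneg hb (p - 1)
      linarith
    · have e' : signedPow p b = -(-b) ^ (p - 1) := by
        rw [← signedPow_of_nonneg hp (neg_nonneg.2 hb), signedPow_neg, neg_neg]
      rw [e, e', neg_le_neg_iff]
      exact Real.rpow_le_rpow (neg_nonneg.2 hb) (neg_le_neg hab) hq

theorem continuous_signedPow {p : ℝ} (hp : 1 < p) : Continuous (signedPow p) := by
  have hq : 0 ≤ p - 1 := (sub_pos.2 hp).le
  have e : signedPow p = fun a => (max a 0) ^ (p - 1) - (max (-a) 0) ^ (p - 1) := by
    funext a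
    rcases le_total 0 a with ha | ha
    · rw [signedPow_of_nonneg hp ha, max_eq_left ha, max_eq_right (neg_nonpos.2 ha),
        Real.zero_rpow (sub_pos.2 hp).ne', sub_zero]
    · rw [max_eq_right ha, max_eq_left (neg_nonneg.2 ha), Real.zero_rpow (sub_pos.2 hp).ne',
        zero_sub, ← signedPow_of_nonneg hp (neg_nonneg.2 ha), signedPow_neg, neg_neg]
  rw [e]
  exact ((continuous_id.max continuous_const).rpow_const fun _ => Or.inr hq).sub
    ((continuous_neg.max continuous_const).rpow_const fun _ => Or.inr hq)

theorem hasDerivAt_abs_rpow_signedPow {p : ℝ} (hp : 1 < p) (a : ℝ) :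
    HasDerivAt (fun s : ℝ => |s| ^ p) (p * signedPow p a) a := by
  rw [signedPow_eq, ← mul_assoc]
  exact hasDerivAt_abs_rpow a hp

/-- The gradient inequality for the convex function `|·|^p`. -/
theorem abs_rpow_add_sub_le {p : ℝ} (hp : 1 < p) (a : ℝ) {t : ℝ} (ht : 0 < t) :
    |a + t| ^ p - |a| ^ p ≤ t * (p * signedPow p (a + t)) := by
  obtain ⟨ξ, hξ, h⟩ := exists_hasDerivAt_eq_slope (fun s : ℝ => |s| ^ p)
    (fun s => p * signedPow p s) (lt_add_of_pos_right a ht)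
    (fun s _ => (hasDerivAt_abs_rpow_signedPow hp s).continuousAt.continuousWithinAt)
    (fun s _ => hasDerivAt_abs_rpow_signedPow hp s)
  have h1 : signedPow p ξ ≤ signedPow p (a + t) := signedPow_mono hp hξ.2.le
  rw [add_sub_cancel_left, eq_div_iff ht.ne'] at h
  have hp0 : 0 < p := by linarith
  rw [← h, mul_comm]
  gcongr

/-- For non-negative numbers `|a - b| ≤ max a b`. Bounding by `r` and `s` lets one majorant serve
all functions below `u`. -/
theorem abs_sub_rpow_le {q a b r s : ℝ} (hq : 0 ≤ q) (ha : 0 ≤ a) (hb : 0 ≤ b)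
    (har : a ≤ r) (hbs : b ≤ s) : |a - b| ^ q ≤ r ^ q + s ^ q := by
  rcases le_total a b with h | h
  · have : |a - b| ^ q ≤ s ^ q :=
      Real.rpow_le_rpow (abs_nonneg _) (by rw [abs_of_nonpos (by linarith)]; linarith) hq
    have := Real.rpow_nonneg (ha.trans har) q
    linarith
  · have : |a - b| ^ q ≤ r ^ q :=
      Real.rpow_le_rpow (abs_nonneg _) (by rw [abs_of_nonneg (by linarith)]; linarith) hq
    have := Real.rpow_nonneg (hb.trans hbs) q
    linarith

theorem rpow_le_two_rpow_mul {q a b : ℝ} (hq : 0 ≤ q) (ha : 0 ≤ a) (hb : 0 ≤ b) :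
    b ^ q ≤ 2 ^ q * (|a - b| ^ q + a ^ q) := by
  have h1 := Real.rpow_nonneg ha q
  have h2 := Real.rpow_nonneg (abs_nonneg (a - b)) q
  have h3 : (0 : ℝ) ≤ 2 ^ q := by positivity
  rcases le_total |a - b| a with h | h
  · calc b ^ q ≤ (2 * a) ^ q :=
          Real.rpow_le_rpow hb (by have := neg_abs_le (a - b); linarith) hq
      _ = 2 ^ q * a ^ q := Real.mul_rpow (by norm_num) ha
      _ ≤ _ := by gcongr; linarith
  · calc b ^ q ≤ (2 * |a - b|) ^ q :=
          Real.rpow_le_rpow hb (by have := neg_abs_le (a - b); linarith) hq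
      _ = 2 ^ q * |a - b| ^ q := Real.mul_rpow (by norm_num) (abs_nonneg _)
      _ ≤ _ := by gcongr; linarith

/-! ### The Schrödinger operator on functions between `0` and `u` -/

/-- Since `u y ≤ 2 max (|u x - u y|) (u x)`, membership in the formal space controls `u y` itself.
The series dominates the operator at `x` for every function between `0` and `u`. -/
theorem summable_formalSpace_bound (G : WeightedGraph X) {p : ℝ} (hp : 1 < p) {V : Set X}
    {u : X → ℝ} (hu : u ∈ G.formalSpace p V) (hu0 : ∀ x, 0 ≤ u x) {x : X} (hx : x ∈ V) :
    Summable (fun y => G.b x y * (u x ^ (p - 1) + u y ^ (p - 1))) := by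
  have hq : 0 ≤ p - 1 := (sub_pos.2 hp).le
  have h1 : Summable (fun y => G.b x y * u x ^ (p - 1)) := (G.summable x).mul_right _
  have h2 : Summable (fun y => G.b x y * u y ^ (p - 1)) := by
    refine Summable.of_nonneg_of_le
      (fun y => mul_nonneg (G.nonneg x y) (Real.rpow_nonneg (hu0 y) _)) (fun y => ?_)
      (((hu x hx).add h1).mul_left (2 ^ (p - 1)))
    have := mul_le_mul_of_nonneg_left (rpow_le_two_rpow_mul hq (hu0 x) (hu0 y)) (G.nonneg x y)
    linarith
  simpa only [mul_add] using h1.add h2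

theorem norm_b_mul_signedPow_le (G : WeightedGraph X) {p : ℝ} (hp : 1 < p) {x y : X}
    {a b r s : ℝ} (ha : 0 ≤ a) (hb : 0 ≤ b) (har : a ≤ r) (hbs : b ≤ s) :
    ‖G.b x y * signedPow p (a - b)‖ ≤ G.b x y * (r ^ (p - 1) + s ^ (p - 1)) := by
  rw [Real.norm_eq_abs, abs_mul, abs_of_nonneg (G.nonneg x y), abs_signedPow hp]
  exact mul_le_mul_of_nonneg_left
    (abs_sub_rpow_le (sub_pos.2 hp).le ha hb har hbs) (G.nonneg x y)

/-- `m H f`, the Schrödinger operator without the factor `1 / m`. -/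
noncomputable def schrodingerForm (G : WeightedGraph X) (p : ℝ) (c f : X → ℝ) (x : X) : ℝ :=
  ∑' y, G.b x y * signedPow p (f x - f y) + c x * signedPow p (f x)

theorem schrodinger_nonneg_iff (G : WeightedGraph X) {p : ℝ} {c m f : X → ℝ} {x : X}
    (hm : 0 < m x) : 0 ≤ G.schrodinger p c m f x ↔ 0 ≤ G.schrodingerForm p c f x := by
  have : G.schrodinger p c m f x = G.schrodingerForm p c f x / m x := by
    rw [schrodinger, laplacian, schrodingerForm]; ring
  rw [this, le_div_iff₀ hm, zero_mul]

/-- Dominated convergence for the Schrödinger operator. -/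
theorem tendsto_schrodingerForm (G : WeightedGraph X) {p : ℝ} (hp : 1 < p) {c : X → ℝ}
    {V : Set X} {u : X → ℝ} (hu : u ∈ G.formalSpace p V) (hu0 : ∀ x, 0 ≤ u x)
    {x : X} (hx : x ∈ V) {ι : Type*} {F : Filter ι} {φ : ι → X → ℝ} {f : X → ℝ}
    (h0 : ∀ᶠ i in F, ∀ y, 0 ≤ φ i y) (hle : ∀ᶠ i in F, ∀ y, φ i y ≤ u y)
    (hlim : ∀ y, Tendsto (fun i => φ i y) F (𝓝 (f y))) :
    Tendsto (fun i => G.schrodingerForm p c (φ i) x) F (𝓝 (G.schrodingerForm p c f x)) := by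
  refine Tendsto.add (tendsto_tsum_of_dominated_convergence
    (G.summable_formalSpace_bound hp hu hu0 hx) (fun y => ?_) ?_) ?_
  · exact (((continuous_signedPow hp).tendsto _).comp ((hlim x).sub (hlim y))).const_mul _
  · filter_upwards [h0, hle] with i h1 h2 y
    exact G.norm_b_mul_signedPow_le hp (h1 x) (h1 y) (h2 x) (h2 y)
  · exact (((continuous_signedPow hp).tendsto _).comp (hlim x)).const_mul _

/-- At a touching point, lowering the neighbours only increases the differences, while the potential
term is unchanged. -/
theorem schrodingerForm_le_of_touching (G : WeightedGraph X) {p : ℝ} (hp : 1 < p) {c : X → ℝ}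
    {V : Set X} {u f : X → ℝ} (hu : u ∈ G.formalSpace p V)
    (h0 : ∀ y, 0 ≤ f y) (hle : ∀ y, f y ≤ u y) {x : X} (hx : x ∈ V) (hfx : f x = u x) :
    G.schrodingerForm p c u x ≤ G.schrodingerForm p c f x := by
  have hu0 : ∀ y, 0 ≤ u y := fun y => (h0 y).trans (hle y)
  have hs := G.summable_formalSpace_bound hp hu hu0 hx
  rw [schrodingerForm, schrodingerForm, hfx]
  gcongr with y
  · exact Summable.of_norm_bounded hs fun y =>
      G.norm_b_mul_signedPow_le hp (hu0 x) (hu0 y) le_rfl le_rfl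
  · exact Summable.of_norm_bounded hs fun y =>
      G.norm_b_mul_signedPow_le hp (hu0 x) (h0 y) le_rfl (hle y)
  · exact G.nonneg x y
  · exact signedPow_mono hp (sub_le_sub_left (hle y) _)

/-! ### The energy on finitely supported functions -/

theorem summable_edge_bound (G : WeightedGraph X) {p : ℝ} (hp : 1 < p) {r : X → ℝ}
    (hr : r.support.Finite) (hr0 : ∀ x, 0 ≤ r x) :
    Summable (fun z : X × X => G.b z.1 z.2 * (r z.1 ^ p + r z.2 ^ p)) := by
  have hp0 : p ≠ 0 := by linarith
  have h1 : Summable (fun z : X × X => G.b z.1 z.2 * r z.1 ^ p) := by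
    have hnn : ∀ z : X × X, 0 ≤ G.b z.1 z.2 * r z.1 ^ p := fun z =>
      mul_nonneg (G.nonneg _ _) (Real.rpow_nonneg (hr0 _) _)
    refine (summable_prod_of_nonneg hnn).2 ⟨fun x => (G.summable x).mul_right (r x ^ p), ?_⟩
    refine summable_of_hasFiniteSupport (hr.subset fun x hx hrx => hx ?_)
    simp [hrx, Real.zero_rpow hp0]
  have h2 : Summable (fun z : X × X => G.b z.1 z.2 * r z.2 ^ p) := by
    have e : (fun z : X × X => G.b z.1 z.2 * r z.2 ^ p) =
        (fun z : X × X => G.b z.1 z.2 * r z.1 ^ p) ∘ Equiv.prodComm X X :=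
      funext fun z => by
        simp only [Function.comp, Equiv.prodComm_apply, Prod.fst_swap, Prod.snd_swap]
        rw [G.symm]
    rw [e]
    exact (Equiv.prodComm X X).summable_iff.2 h1
  simpa only [mul_add] using h1.add h2

theorem edge_term_le (G : WeightedGraph X) {p : ℝ} (hp : 1 < p) {r φ : X → ℝ}
    (h0 : ∀ x, 0 ≤ φ x) (hle : ∀ x, φ x ≤ r x) (z : X × X) :
    G.b z.1 z.2 * |φ z.1 - φ z.2| ^ p ≤ G.b z.1 z.2 * (r z.1 ^ p + r z.2 ^ p) :=
  mul_le_mul_of_nonneg_left (abs_sub_rpow_le (by linarith) (h0 _) (h0 _) (hle _) (hle _))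
    (G.nonneg _ _)

theorem edge_term_nonneg (G : WeightedGraph X) (p : ℝ) (φ : X → ℝ) (z : X × X) :
    0 ≤ G.b z.1 z.2 * |φ z.1 - φ z.2| ^ p :=
  mul_nonneg (G.nonneg _ _) (Real.rpow_nonneg (abs_nonneg _) _)

theorem summable_energy_edges (G : WeightedGraph X) {p : ℝ} (hp : 1 < p) {φ : X → ℝ}
    (hφ : φ.support.Finite) (h0 : ∀ x, 0 ≤ φ x) :
    Summable (fun z : X × X => G.b z.1 z.2 * |φ z.1 - φ z.2| ^ p) :=
  Summable.of_nonneg_of_le (G.edge_term_nonneg p φ) (G.edge_term_le hp h0 fun _ => le_rfl)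
    (G.summable_edge_bound hp hφ h0)

theorem summable_mul_abs_rpow {p : ℝ} (hp : 1 < p) {φ : X → ℝ} (c : X → ℝ)
    (hφ : φ.support.Finite) : Summable (fun x => c x * |φ x| ^ p) := by
  have hp0 : p ≠ 0 := by linarith
  refine summable_of_hasFiniteSupport (hφ.subset fun x hx => ?_)
  contrapose! hx
  have hx' : φ x = 0 := by simpa using hx
  simp [hx', Real.zero_rpow hp0]

theorem continuousOn_energy (G : WeightedGraph X) {p : ℝ} (hp : 1 < p) (c : X → ℝ) {r : X → ℝ}
    (hr : r.support.Finite) (hr0 : ∀ x, 0 ≤ r x) :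
    ContinuousOn (G.energy p c) (Set.Icc 0 r) := by
  have hp0 : 0 ≤ p := by linarith
  refine ContinuousOn.add (continuousOn_const.mul (continuousOn_tsum (fun z => ?_)
    (G.summable_edge_bound hp hr hr0) fun z φ hφ => ?_)) (continuousOn_tsum (fun x => ?_)
    (summable_mul_abs_rpow hp (fun x => |c x|) hr) fun x φ hφ => ?_)
  · exact (continuous_const.mul ((((continuous_apply z.1).sub
      (continuous_apply z.2)).abs).rpow_const fun _ => Or.inr hp0)).continuousOn
  · rw [Real.norm_of_nonneg (G.edge_term_nonneg p φ z)]
    exact G.edge_term_le hp hφ.1 hφ.2 z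
  · exact (continuous_const.mul
      ((continuous_apply x).abs.rpow_const fun _ => Or.inr hp0)).continuousOn
  · rw [Real.norm_eq_abs, abs_mul, abs_of_nonneg (Real.rpow_nonneg (abs_nonneg _) p)]
    refine mul_le_mul_of_nonneg_left (Real.rpow_le_rpow (abs_nonneg _) ?_ hp0) (abs_nonneg _)
    rw [abs_of_nonneg (hφ.1 x), abs_of_nonneg (hr0 x)]
    exact hφ.2 x

open Classical in
/-- The change of the energy when the value at one vertex changes. -/
theorem energy_update_sub (G : WeightedGraph X) {p : ℝ} (hp : 1 < p) (c : X → ℝ) {φ : X → ℝ}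
    (hφ : φ.support.Finite) (h0 : ∀ x, 0 ≤ φ x) (x : X) {s : ℝ} (hs : 0 ≤ s) :
    (Summable fun y => G.b x y * (|s - φ y| ^ p - |φ x - φ y| ^ p)) ∧
    G.energy p c (Function.update φ x s) - G.energy p c φ =
      ∑' y, G.b x y * (|s - φ y| ^ p - |φ x - φ y| ^ p) + c x * (|s| ^ p - |φ x| ^ p) := by
  set ψ := Function.update φ x s with hψ
  have hψx : ψ x = s := by simp [hψ]
  have hψy : ∀ y, y ≠ x → ψ y = φ y := fun y hy => by simp [hψ, hy]
  have hψ0 : ∀ y, 0 ≤ ψ y := fun y => by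
    by_cases hy : y = x
    · rw [hy, hψx]; exact hs
    · rw [hψy y hy]; exact h0 y
  have hψs : ψ.support.Finite := by
    refine (hφ.insert x).subset fun y hy => ?_
    by_cases h : y = x
    · exact Or.inl h
    · rw [Function.mem_support, hψy y h] at hy; exact Or.inr hy
  have e1 := G.summable_energy_edges hp hφ h0
  have e2 := G.summable_energy_edges hp hψs hψ0
  have hd := e2.sub e1
  set d : X × X → ℝ := fun z =>
    G.b z.1 z.2 * |ψ z.1 - ψ z.2| ^ p - G.b z.1 z.2 * |φ z.1 - φ z.2| ^ p with hdd
  have hdx : ∀ y, d (x, y) = G.b x y * (|s - φ y| ^ p - |φ x - φ y| ^ p) := fun y => by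
    by_cases hy : y = x
    · simp [hdd, hy, G.diag]
    · simp only [hdd, hψx, hψy y hy]; ring
  have hinj : Function.Injective (fun y : X => (x, y)) := fun a b h => (Prod.mk.inj h).2
  have hsum : Summable fun y => d (x, y) := hd.comp_injective hinj
  -- Changed edges start or end at `x`, and by symmetry both families have the same sum; this factor
  -- 2 cancels the `1 / 2` in the energy. The loop at `x`, in both families, has weight zero.
  have hg : HasSum (fun z : X × X => if z.1 = x then d z else 0) (∑' y, d (x, y)) := by
    have := (hinj.hasSum_iff (f := fun z : X × X => if z.1 = x then d z else 0)
      (a := ∑' y, d (x, y)) fun z hz => if_neg fun h => hz ⟨z.2, by rw [← h]⟩).1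
    apply this
    convert hsum.hasSum using 2
    simp
  have hg' : HasSum (fun z : X × X => if z.2 = x then d z else 0) (∑' y, d (x, y)) := by
    rw [← (Equiv.prodComm X X).hasSum_iff]
    convert hg using 2 with z
    simp only [Function.comp, Equiv.prodComm_apply, Prod.snd_swap]
    congr 1
    simp only [hdd, Prod.fst_swap, Prod.snd_swap]
    rw [G.symm z.2 z.1, abs_sub_comm (ψ z.2), abs_sub_comm (φ z.2)]
  have hdsum : ∑' z, d z = 2 * ∑' y, d (x, y) := by
    rw [two_mul, ← (hg.add hg').tsum_eq]
    refine tsum_congr fun z => ?_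
    obtain ⟨a, b⟩ := z
    by_cases ha : a = x <;> by_cases hb : b = x
    · simp [ha, hb, hdd, G.diag]
    · simp [ha, hb]
    · simp [ha, hb]
    · simp [ha, hb, hdd, hψy a ha, hψy b hb]
  have hc : ∑' y, c y * |ψ y| ^ p - ∑' y, c y * |φ y| ^ p = c x * (|s| ^ p - |φ x| ^ p) := by
    rw [← (summable_mul_abs_rpow hp c hψs).tsum_sub (summable_mul_abs_rpow hp c hφ),
      tsum_eq_single x fun y hy => by rw [hψy y hy, sub_self], hψx]
    ring
  refine ⟨by simpa only [hdx] using hsum, ?_⟩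
  rw [energy, energy, ← hc]
  simp only [← hdx]
  have := hdsum.symm.trans (e2.tsum_sub e1)
  linarith

/-! ### Minimisers and the minimum principle -/

open Classical in
/-- Minimisers of the energy in a box below a supersolution `u` are supersolutions wherever the
upper obstacle agrees with `u`. -/
theorem schrodingerForm_nonneg_of_minimizer (G : WeightedGraph X) {p : ℝ} (hp : 1 < p)
    {c : X → ℝ} {V : Set X} {u l r φ : X → ℝ} (hu : u ∈ G.formalSpace p V)
    (hr : r.support.Finite) (hl0 : 0 ≤ l) (hru : r ≤ u) (hφ : φ ∈ Set.Icc l r)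
    (hmin : ∀ ψ ∈ Set.Icc l r, G.energy p c φ ≤ G.energy p c ψ) {x : X} (hx : x ∈ V)
    (hrx : r x = u x) (hux : 0 ≤ G.schrodingerForm p c u x) :
    0 ≤ G.schrodingerForm p c φ x := by
  have hp0 : 0 < p := by linarith
  have h0 : ∀ y, 0 ≤ φ y := fun y => (hl0 y).trans (hφ.1 y)
  have hle : ∀ y, φ y ≤ u y := fun y => (hφ.2 y).trans (hru y)
  have hu0 : ∀ y, 0 ≤ u y := fun y => (h0 y).trans (hle y)
  have hbd := G.summable_formalSpace_bound hp hu hu0 hx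
  rcases (hle x).eq_or_lt with htouch | hlt
  · exact hux.trans (G.schrodingerForm_le_of_touching hp hu h0 hle hx htouch)
  have hφs : φ.support.Finite := hr.subset fun y hy hry => hy
    (le_antisymm ((hφ.2 y).trans hry.le) (h0 y))
  -- Below the obstacle, the value at `x` can be raised slightly without leaving the box, so the
  -- right derivative of the energy is non-negative.
  have hev : ∀ᶠ t : ℝ in 𝓝[>] 0, t ∈ Set.Ioo 0 (u x - φ x) :=
    Ioo_mem_nhdsGT (sub_pos.2 hlt)
  have hlimA : Tendsto (fun t : ℝ => ∑' y, G.b x y * signedPow p (φ x + t - φ y)) (𝓝[>] 0)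
      (𝓝 (∑' y, G.b x y * signedPow p (φ x - φ y))) := by
    refine tendsto_tsum_of_dominated_convergence hbd (fun y => ?_) ?_
    · have hc : Continuous fun t : ℝ => G.b x y * signedPow p (φ x + t - φ y) :=
        continuous_const.mul ((continuous_signedPow hp).comp (by fun_prop))
      have := hc.tendsto 0
      rw [add_zero] at this
      exact this.mono_left nhdsWithin_le_nhds
    · filter_upwards [hev] with t ht y
      exact G.norm_b_mul_signedPow_le hp (add_nonneg (h0 x) ht.1.le) (h0 y)
        (by linarith [ht.2]) (hle y)
  have hlimc := (hasDerivAt_abs_rpow_signedPow hp (φ x)).tendsto_slope_zero_right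
  have hlim := (hlimA.const_mul p).add (hlimc.const_mul (c x))
  have hnn : 0 ≤ p * ∑' y, G.b x y * signedPow p (φ x - φ y) +
      c x * (p * signedPow p (φ x)) := by
    refine ge_of_tendsto hlim ?_
    filter_upwards [hev] with t ht
    have hs0 : 0 ≤ φ x + t := add_nonneg (h0 x) ht.1.le
    have hmem : Function.update φ x (φ x + t) ∈ Set.Icc l r := by
      constructor
      · intro y
        rcases eq_or_ne y x with rfl | hy
        · simpa using (hφ.1 y).trans (le_add_of_nonneg_right ht.1.le)
        · simpa [hy] using hφ.1 y
      · intro y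
        rcases eq_or_ne y x with rfl | hy
        · simp only [Function.update_self, hrx]; linarith [ht.2]
        · simpa [hy] using hφ.2 y
    obtain ⟨hsum, he⟩ := G.energy_update_sub hp c hφs h0 x hs0
    have h1 := hmin _ hmem
    have hsA : Summable fun y => G.b x y * signedPow p (φ x + t - φ y) :=
      Summable.of_norm_bounded hbd fun y => G.norm_b_mul_signedPow_le hp hs0 (h0 y)
        (by linarith [ht.2]) (hle y)
    -- Convexity bounds the edge increments by derivatives at the shifted point, which converge by
    -- domination. The potential has no sign, so its difference quotient is kept.
    have h2 : ∑' y, G.b x y * (|φ x + t - φ y| ^ p - |φ x - φ y| ^ p) ≤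
        t * (p * ∑' y, G.b x y * signedPow p (φ x + t - φ y)) := by
      rw [← mul_assoc, ← tsum_mul_left]
      refine hsum.tsum_le_tsum (fun y => ?_) (hsA.mul_left _)
      have h3 := mul_le_mul_of_nonneg_left (abs_rpow_add_sub_le hp (φ x - φ y) ht.1)
        (G.nonneg x y)
      rw [show φ x - φ y + t = φ x + t - φ y by ring] at h3
      linarith
    have h4 : 0 ≤ t * (p * ∑' y, G.b x y * signedPow p (φ x + t - φ y) +
        c x * (t⁻¹ • (|φ x + t| ^ p - |φ x| ^ p))) := by
      have : t * (c x * (t⁻¹ • (|φ x + t| ^ p - |φ x| ^ p))) =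
          c x * (|φ x + t| ^ p - |φ x| ^ p) := by
        rw [smul_eq_mul]; field_simp [ht.1.ne']
      rw [mul_add, this]
      linarith
    exact nonneg_of_mul_nonneg_right h4 ht.1
  rw [schrodingerForm]
  refine nonneg_of_mul_nonneg_right (a := p) ?_ hp0
  linarith

/-- Strong minimum principle. -/
theorem pos_of_schrodingerForm_nonneg (G : WeightedGraph X) {p : ℝ} (hp : 1 < p) {c : X → ℝ}
    {V K : Set X} (hV : G.ConnectedOn V) (hKV : K ⊆ V) (hK : K.Nonempty) {f : X → ℝ}
    (hf : f ∈ G.formalSpace p (V \ K)) (hf0 : ∀ x, 0 ≤ f x) (hfK : ∀ x ∈ K, 0 < f x)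
    (hH : ∀ x ∈ V \ K, 0 ≤ G.schrodingerForm p c f x) : ∀ x ∈ V, 0 < f x := by
  have hq : p - 1 ≠ 0 := (sub_pos.2 hp).ne'
  intro x hx
  by_contra hcon
  have hfx : f x = 0 := le_antisymm (not_lt.1 hcon) (hf0 x)
  obtain ⟨o, ho⟩ := hK
  have hpath := hV x hx o (hKV ho)
  refine (hfK o ho).ne' ?_
  clear ho
  induction hpath with
  | refl => exact hfx
  | @tail a y _ hay ih =>
    obtain ⟨haV, -, hadj⟩ := hay
    have haK : a ∉ K := fun h => (hfK a h).ne' ih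
    have hsum := hf a ⟨haV, haK⟩
    have hnn : ∀ z, 0 ≤ G.b a z * |f a - f z| ^ (p - 1) := fun z =>
      mul_nonneg (G.nonneg a z) (Real.rpow_nonneg (abs_nonneg _) _)
    have h1 := hH a ⟨haV, haK⟩
    -- At a zero of `f` every term of the operator is non-positive, so all vanish and the zero
    -- spreads to the neighbours, along the path into `K`.
    have h2 : ∀ z, G.b a z * signedPow p (f a - f z) = -(G.b a z * |f a - f z| ^ (p - 1)) := by
      intro z
      rw [ih, zero_sub, signedPow_neg, signedPow_of_nonneg hp (hf0 z), abs_neg,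
        abs_of_nonneg (hf0 z), mul_neg]
    have h3 : signedPow p (f a) = 0 := by rw [ih]; simp [signedPow]
    rw [schrodingerForm, h3, mul_zero, add_zero] at h1
    simp only [h2, tsum_neg] at h1
    have h4 := hsum.le_tsum y fun z _ => hnn z
    have h5 : G.b a y * |f a - f y| ^ (p - 1) = 0 := le_antisymm (by linarith) (hnn y)
    have h6 := (mul_eq_zero.1 h5).resolve_left hadj.ne'
    have h7 := (Real.rpow_eq_zero (abs_nonneg _) hq).1 h6
    rw [ih, zero_sub, abs_neg] at h7
    exact abs_eq_zero.1 h7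

/-! ### Approximation of functions of minimal growth -/

/-- Functions of minimal growth are limits of finitely supported functions of bounded energy. -/
theorem exists_tendsto_of_mem_minimalGrowth (G : WeightedGraph X) {p : ℝ} (hp : 1 < p)
    {c m : X → ℝ} {V K K' : Set X} (hm : ∀ x ∈ V, 0 < m x) (hV : G.ConnectedOn V)
    (hKK' : K ⊆ K') (hK'V : K' ⊆ V) (hK'f : K'.Finite) (hK'n : K'.Nonempty)
    (hK'c : G.ConnectedOn K') {u : X → ℝ} (hu : u ∈ G.minimalGrowth p c m V K) :
    ∃ (F : Ultrafilter (Finset X)) (φ : Finset X → X → ℝ) (B : ℝ),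
      (∀ i, IsCc V (φ i)) ∧ (∀ i x, 0 ≤ φ i x) ∧ (∀ i x, φ i x ≤ u x) ∧
      (∀ i, G.energy p c (φ i) ≤ B) ∧ ∀ x ∈ V, Tendsto (fun i => φ i x) F (𝓝 (u x)) := by
  classical
  obtain ⟨⟨hu0, hupos⟩, ⟨huF, huH⟩, hgrowth⟩ := hu
  have huF' : u ∈ G.formalSpace p (V \ K') := fun x hx => huF x ⟨hx.1, fun h => hx.2 (hKK' h)⟩
  have huH' : ∀ x ∈ V \ K', 0 ≤ G.schrodingerForm p c u x := fun x hx =>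
    (G.schrodinger_nonneg_iff (hm x hx.1)).1 (huH x ⟨hx.1, fun h => hx.2 (hKK' h)⟩).ge
  -- Both obstacles equal `u` on `K'`, which pins the minimisers there; each point of `V` eventually
  -- lies in `S T`.
  set S : Finset X → Set X := fun T => K' ∪ (↑T ∩ V)
  set l : X → ℝ := K'.indicator u
  set r : Finset X → X → ℝ := fun T => (S T).indicator u
  have hSf : ∀ T, (S T).Finite := fun T => hK'f.union (T.finite_toSet.inter_of_left V)
  have hSV : ∀ T, S T ⊆ V := fun T => Set.union_subset hK'V Set.inter_subset_right
  have hrs : ∀ T, (r T).support ⊆ S T := fun T => Set.support_indicator_subset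
  have hl0 : 0 ≤ l := fun x => Set.indicator_nonneg (fun y _ => hu0 y) x
  have hlr : ∀ T, l ≤ r T := fun T =>
    Set.indicator_le_indicator_of_subset Set.subset_union_left hu0
  have hru : ∀ T, r T ≤ u := fun T => Set.indicator_le_self' fun x _ => hu0 x
  have hex : ∀ T, ∃ φ ∈ Set.Icc l (r T), ∀ ψ ∈ Set.Icc l (r T),
      G.energy p c φ ≤ G.energy p c ψ := fun T =>
    isCompact_Icc.exists_isMinOn ⟨l, le_rfl, hlr T⟩
      ((G.continuousOn_energy hp c ((hSf T).subset (hrs T)) fun x =>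
        (hl0 x).trans (hlr T x)).mono (Set.Icc_subset_Icc_left hl0))
  choose φ hφ hmin using hex
  have hφ0 : ∀ T x, 0 ≤ φ T x := fun T x => (hl0 x).trans ((hφ T).1 x)
  have hφu : ∀ T x, φ T x ≤ u x := fun T x => ((hφ T).2 x).trans (hru T x)
  have hφs : ∀ T, (φ T).support ⊆ S T := fun T x hx => hrs T fun h =>
    hx (le_antisymm (((hφ T).2 x).trans h.le) (hφ0 T x))
  let F : Ultrafilter (Finset X) := Ultrafilter.of atTop
  have hF : (F : Filter (Finset X)) ≤ atTop := Ultrafilter.of_le atTop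
  obtain ⟨f, ⟨hf0, hfu⟩, hf⟩ := (isCompact_Icc (a := (0 : X → ℝ)) (b := u)).ultrafilter_le_nhds
    (F.map φ) (le_principal_iff.2 (mem_map.2 (univ_mem' fun T => ⟨hφ0 T, hφu T⟩)))
  have hlim : ∀ x, Tendsto (fun T => φ T x) F (𝓝 (f x)) := fun x =>
    ((continuous_apply x).tendsto f).comp hf
  have hlK : ∀ x ∈ K', f x = u x := fun x hx => by
    have : ∀ T, φ T x = u x := fun T =>
      le_antisymm (hφu T x) (by simpa [l, hx] using (hφ T).1 x)
    refine tendsto_nhds_unique (hlim x) ?_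
    simp only [this]
    exact tendsto_const_nhds
  have hfF : f ∈ G.formalSpace p (V \ K') := fun x hx =>
    Summable.of_nonneg_of_le
      (fun y => mul_nonneg (G.nonneg x y) (Real.rpow_nonneg (abs_nonneg _) _))
      (fun y => mul_le_mul_of_nonneg_left (abs_sub_rpow_le (sub_pos.2 hp).le (hf0 x) (hf0 y)
        (hfu x) (hfu y)) (G.nonneg x y))
      (G.summable_formalSpace_bound hp huF' hu0 hx)
  have hfH : ∀ x ∈ V \ K', 0 ≤ G.schrodingerForm p c f x := fun x hx => by
    refine ge_of_tendsto (G.tendsto_schrodingerForm hp huF' hu0 hx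
      (Eventually.of_forall hφ0) (Eventually.of_forall hφu) hlim) ?_
    filter_upwards [hF (eventually_ge_atTop {x})] with T hT
    refine G.schrodingerForm_nonneg_of_minimizer hp huF' ((hSf T).subset (hrs T)) hl0 (hru T)
      (hφ T) (hmin T) hx ?_ (huH' x hx)
    have hxS : x ∈ S T := Or.inr ⟨hT (Finset.mem_singleton_self x), hx.1⟩
    exact Set.indicator_of_mem hxS u
  have hfpos := G.pos_of_schrodingerForm_nonneg hp hV hK'V hK'n hfF hf0
    (fun x hx => by rw [hlK x hx]; exact hupos x (hK'V hx)) hfH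
  -- The limit `f` itself serves as the superharmonic competitor.
  have hge := hgrowth K' hK'f hK'n hK'c hK'V hKK' f ⟨hf0, hfpos⟩
    ⟨hfF, fun x hx => (G.schrodinger_nonneg_iff (hm x hx.1)).2 (hfH x hx)⟩
    (fun x hx => (hlK x hx).ge)
  have hcc : ∀ T, IsCc V (φ T) := fun T => ⟨(hSf T).subset (hφs T), (hφs T).trans (hSV T)⟩
  refine ⟨F, φ, G.energy p c l, hcc, hφ0, hφu, fun T => hmin T l ⟨le_rfl, hlr T⟩, fun x hx => ?_⟩
  by_cases hxK : x ∈ K'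
  · exact hlK x hxK ▸ hlim x
  · exact le_antisymm (hge x ⟨hx, hxK⟩) (hfu x) ▸ hlim x

/-- Minimal growth is tested on connected sets only, so `K` is enlarged by finite paths in `V` from
a common root. -/
theorem exists_finite_connectedOn (G : WeightedGraph X) {V K : Set X} (hV : G.ConnectedOn V)
    (hKV : K ⊆ V) (hK : K.Finite) (hKn : K.Nonempty) :
    ∃ K' : Set X, K'.Finite ∧ K ⊆ K' ∧ K' ⊆ V ∧ G.ConnectedOn K' := by
  obtain ⟨o, ho⟩ := hKn
  let R : Set X → X → X → Prop := fun P a a' => a ∈ P ∧ a' ∈ P ∧ G.Adj a a'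
  have hmono : ∀ {P Q : Set X} {a a' : X}, P ⊆ Q → Relation.ReflTransGen (R P) a a' →
      Relation.ReflTransGen (R Q) a a' := fun hPQ h =>
    Relation.ReflTransGen.lift id (fun _ _ h => ⟨hPQ h.1, hPQ h.2.1, h.2.2⟩) _ _ h
  have hpath : ∀ x ∈ V, ∃ P : Set X, P.Finite ∧ P ⊆ V ∧ x ∈ P ∧
      ∀ z ∈ P, Relation.ReflTransGen (R P) o z := by
    intro x hx
    induction hV o (hKV ho) x hx with
    | refl => exact ⟨{o}, Set.finite_singleton o, Set.singleton_subset_iff.2 (hKV ho), rfl,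
        fun z hz => hz ▸ .refl⟩
    | @tail a y _ hay ih =>
      obtain ⟨P, hPf, hPV, haP, hP⟩ := ih hay.1
      have hsub : P ⊆ insert y P := Set.subset_insert y P
      refine ⟨insert y P, hPf.insert y, Set.insert_subset hx hPV, Set.mem_insert y P,
        fun z hz => ?_⟩
      rcases hz with rfl | hz
      · exact (hmono hsub (hP a haP)).tail ⟨hsub haP, Set.mem_insert z P, hay.2.2⟩
      · exact hmono hsub (hP z hz)
  choose! P hPf hPV hxP hP using hpath
  refine ⟨⋃ x ∈ K, P x, hK.biUnion fun x hx => hPf x (hKV hx),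
    fun x hx => Set.mem_biUnion hx (hxP x (hKV hx)), Set.iUnion₂_subset fun x hx =>
      hPV x (hKV hx), ?_⟩
  have hroot : ∀ z ∈ ⋃ x ∈ K, P x, Relation.ReflTransGen (R (⋃ x ∈ K, P x)) o z := by
    intro z hz
    obtain ⟨x, hx, hzx⟩ := Set.mem_iUnion₂.1 hz
    exact hmono (Set.subset_biUnion_of_mem hx) (hP x (hKV hx) z hzx)
  have : Std.Symm (R (⋃ x ∈ K, P x)) := ⟨fun a a' h =>
    ⟨h.2.1, h.1, show 0 < G.b a' a by rw [G.symm]; exact h.2.2⟩⟩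
  intro x hx y hy
  exact (Relation.ReflTransGen.stdSymm.symm _ _ (hroot x hx)).trans (hroot y hy)

/-! ### Fatou's lemma and cutting off along `W` -/

/-- Fatou's lemma for the weight functional. -/
theorem summable_rpow_mul_of_weightFunctional_le {p : ℝ} (hp : 1 < p) {U : Set X} {w u : X → ℝ}
    (hw : ∀ x ∈ U, 0 ≤ w x) {ι : Type*} {F : Filter ι} [F.NeBot] {φ : ι → X → ℝ} {B : ℝ}
    (hφ : ∀ i, IsCc U (φ i)) (hB : ∀ i, weightFunctional p w (φ i) ≤ B)
    (hlim : ∀ x ∈ U, Tendsto (fun i => φ i x) F (𝓝 (u x))) :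
    Summable (fun x : U => |u x| ^ p * w x) := by
  have hp0 : 0 < p := by linarith
  refine summable_of_sum_le
    (fun x => mul_nonneg (Real.rpow_nonneg (abs_nonneg _) p) (hw x x.2)) (c := B) fun T => ?_
  have ht : Tendsto (fun i => ∑ x ∈ T, |φ i x| ^ p * w x) F (𝓝 (∑ x ∈ T, |u x| ^ p * w x)) :=
    tendsto_finsetSum T fun x _ =>
      ((hlim x x.2).abs.rpow_const (Or.inr hp0.le)).mul_const (w x)
  refine le_of_tendsto ht (Eventually.of_forall fun i => le_trans ?_ (hB i))
  have hnn : ∀ x, 0 ≤ |φ i x| ^ p * w x := fun x => by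
    by_cases hx : x ∈ U
    · exact mul_nonneg (Real.rpow_nonneg (abs_nonneg _) p) (hw x hx)
    · have : φ i x = 0 := by_contra fun h => hx ((hφ i).2 h)
      simp [this, Real.zero_rpow hp0.ne']
  have hs : Summable fun x => |φ i x| ^ p * w x :=
    (summable_mul_abs_rpow hp w (hφ i).1).congr fun x => mul_comm _ _
  have := hs.sum_le_tsum (T.map (Function.Embedding.subtype _)) fun x _ => hnn x
  rw [Finset.sum_map] at this
  exact this

/-- Restricting a non-negative test function to `V \ W` raises the energy at most by the weight of
the boundary edges. -/
theorem energy_indicator_diff_le (G : WeightedGraph X) {p : ℝ} (hp : 1 < p) {c : X → ℝ}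
    {V W : Set X} (hWV : W ⊆ V) (hh : G.EnergyNonneg p c V) {u : X → ℝ}
    (hu0 : ∀ x, 0 ≤ u x) (hupos : ∀ x ∈ V, 0 < u x)
    (hdeg : u ∈ weightedLp p (V \ W) (G.degOn W)) {C : ℝ}
    (hC : ∀ x ∈ W, ∀ y ∈ V \ W, G.Adj x y → u x / u y ≤ C) :
    ∃ B : ℝ, ∀ φ : X → ℝ, IsCc V φ → (∀ x, 0 ≤ φ x) → (∀ x, φ x ≤ u x) →
      G.energy p c ((V \ W).indicator φ) ≤ G.energy p c φ + B := by
  classical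
  have hp0 : 0 < p := by linarith
  -- Without edges between `W` and `V \ W`, `C` may be negative.
  set C' := max C 0
  have hC'0 : 0 ≤ C' := le_max_right _ _
  set R : X × X → ℝ := fun z => (1 + C' ^ p) *
    (V \ W).indicator (fun a => W.indicator (fun d => u a ^ p * G.b a d) z.2) z.1 with hR
  have hRmem : ∀ a ∈ V \ W, ∀ d ∈ W, R (a, d) = (1 + C' ^ p) * (u a ^ p * G.b a d) :=
    fun a ha d hd => by simp only [hR, Set.indicator_of_mem ha, Set.indicator_of_mem hd]
  have hin : ∀ z : X × X, 0 ≤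
      (V \ W).indicator (fun a => W.indicator (fun d => u a ^ p * G.b a d) z.2) z.1 := fun z =>
    Set.indicator_nonneg (fun a _ => Set.indicator_nonneg (fun d _ =>
      mul_nonneg (Real.rpow_nonneg (hu0 a) p) (G.nonneg a d)) _) _
  have hR0 : ∀ z, 0 ≤ R z := fun z => mul_nonneg (by positivity) (hin z)
  have hRs : Summable R := by
    refine Summable.mul_left _ ((summable_prod_of_nonneg hin).2 ⟨fun a => ?_, ?_⟩)
    · by_cases ha : a ∈ V \ W
      · simp only [Set.indicator_of_mem ha]
        exact ((G.summable a).mul_left _).indicator W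
      · simp only [Set.indicator_of_notMem ha]
        exact summable_zero
    · have h1 : Summable fun x : ↥(V \ W) => |u x| ^ p * G.degOn W x := hdeg
      have h2 := (summable_subtype_iff_indicator
        (f := fun x => |u x| ^ p * G.degOn W x)).1 h1
      refine h2.congr fun a => ?_
      by_cases ha : a ∈ V \ W
      · simp only [Set.indicator_of_mem ha]
        rw [degOn, abs_of_nonneg (hu0 a), ← tsum_mul_left]
        exact tsum_subtype W fun d => u a ^ p * G.b a d
      · simp only [Set.indicator_of_notMem ha, tsum_zero]
  have hRs' : Summable (fun z : X × X => R z.swap) := (Equiv.prodComm X X).summable_iff.2 hRs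
  refine ⟨1 / 2 * ∑' z, (R z + R z.swap), fun φ hφ h0 hle => ?_⟩
  set φ₁ := W.indicator φ
  set φ₂ := (V \ W).indicator φ
  have hφ₁s : φ₁.support.Finite := hφ.1.subset (Set.support_indicator.trans_subset
    Set.inter_subset_right)
  have hφ₂s : φ₂.support.Finite := hφ.1.subset (Set.support_indicator.trans_subset
    Set.inter_subset_right)
  have hφ₁0 : ∀ x, 0 ≤ φ₁ x := fun x => Set.indicator_nonneg (fun y _ => h0 y) x
  have hφ₂0 : ∀ x, 0 ≤ φ₂ x := fun x => Set.indicator_nonneg (fun y _ => h0 y) x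
  have hW : ∀ x ∈ W, φ₁ x = φ x ∧ φ₂ x = 0 := fun x hx =>
    ⟨Set.indicator_of_mem hx φ, Set.indicator_of_notMem (fun h => h.2 hx) φ⟩
  have hVW : ∀ x ∉ W, φ₁ x = 0 ∧ φ₂ x = φ x := fun x hx => by
    refine ⟨Set.indicator_of_notMem hx φ, ?_⟩
    by_cases hxV : x ∈ V
    · exact Set.indicator_of_mem (show x ∈ V \ W from ⟨hxV, hx⟩) φ
    · have : φ x = 0 := by_contra fun h => hxV (hφ.2 h)
      rw [this]
      exact Set.indicator_of_notMem (fun h => hxV h.1) φ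
  -- Cutting the edge from `a` to `d` leaves `φ a ^ p + φ d ^ p`, at most `(C' ^ p + 1) * u d ^ p`
  -- if `d ∈ V`. If `d ∉ V`, then `φ d = 0` and nothing is lost.
  have hcross : ∀ a ∈ W, ∀ d ∉ W,
      G.b a d * |φ a| ^ p + G.b a d * |φ d| ^ p ≤ G.b a d * |φ a - φ d| ^ p + R (d, a) := by
    intro a ha d hd
    have hn : 0 ≤ G.b a d * |φ a - φ d| ^ p :=
      mul_nonneg (G.nonneg a d) (Real.rpow_nonneg (abs_nonneg _) p)
    by_cases hdV : d ∈ V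
    · rcases (G.nonneg a d).eq_or_lt with hb | hb
      · rw [← hb]; simpa using hR0 (d, a)
      · have h1 := (div_le_iff₀ (hupos d hdV)).1 (hC a ha d ⟨hdV, hd⟩ hb)
        have h2 : φ a ≤ C' * u d := (hle a).trans (h1.trans
          (mul_le_mul_of_nonneg_right (le_max_left _ _) (hu0 d)))
        have h3 : |φ a| ^ p ≤ C' ^ p * u d ^ p := by
          rw [abs_of_nonneg (h0 a), ← Real.mul_rpow hC'0 (hu0 d)]
          exact Real.rpow_le_rpow (h0 a) h2 hp0.le
        have h4 : |φ d| ^ p ≤ u d ^ p := by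
          rw [abs_of_nonneg (h0 d)]; exact Real.rpow_le_rpow (h0 d) (hle d) hp0.le
        rw [hRmem d ⟨hdV, hd⟩ a ha, G.symm d a]
        have h5 := mul_le_mul_of_nonneg_left (add_le_add h3 h4) hb.le
        linarith
    · have : φ d = 0 := by_contra fun h => hdV (hφ.2 h)
      simpa [this, Real.zero_rpow hp0.ne'] using hR0 (d, a)
  have e := G.summable_energy_edges hp hφ.1 h0
  have e₁ := G.summable_energy_edges hp hφ₁s hφ₁0
  have e₂ := G.summable_energy_edges hp hφ₂s hφ₂0
  have hedge : ∀ z : X × X,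
      G.b z.1 z.2 * |φ₁ z.1 - φ₁ z.2| ^ p + G.b z.1 z.2 * |φ₂ z.1 - φ₂ z.2| ^ p ≤
        G.b z.1 z.2 * |φ z.1 - φ z.2| ^ p + (R z + R z.swap) := by
    rintro ⟨a, d⟩
    have hRa := hR0 (a, d)
    have hRd := hR0 (d, a)
    simp only [Prod.swap_prod_mk]
    by_cases ha : a ∈ W <;> by_cases hd : d ∈ W
    · rw [(hW a ha).1, (hW a ha).2, (hW d hd).1, (hW d hd).2, sub_zero, abs_zero,
        Real.zero_rpow hp0.ne']
      linarith
    · rw [(hW a ha).1, (hW a ha).2, (hVW d hd).1, (hVW d hd).2, sub_zero, zero_sub, abs_neg]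
      linarith [hcross a ha d hd]
    · rw [(hW d hd).1, (hW d hd).2, (hVW a ha).1, (hVW a ha).2, sub_zero, zero_sub, abs_neg]
      have := hcross d hd a ha
      rw [G.symm d a, abs_sub_comm] at this
      linarith
    · rw [(hVW a ha).1, (hVW a ha).2, (hVW d hd).1, (hVW d hd).2, sub_zero, abs_zero,
        Real.zero_rpow hp0.ne']
      linarith
  have hE := (e₁.add e₂).tsum_le_tsum hedge (e.add (hRs.add hRs'))
  rw [e₁.tsum_add e₂, e.tsum_add (hRs.add hRs')] at hE
  have hP : ∑' x, c x * |φ₁ x| ^ p + ∑' x, c x * |φ₂ x| ^ p = ∑' x, c x * |φ x| ^ p := by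
    rw [← (summable_mul_abs_rpow hp c hφ₁s).tsum_add (summable_mul_abs_rpow hp c hφ₂s)]
    refine tsum_congr fun x => ?_
    by_cases hx : x ∈ W
    · simp [hW x hx, Real.zero_rpow hp0.ne']
    · simp [hVW x hx, Real.zero_rpow hp0.ne']
  have hpos : 0 ≤ G.energy p c φ₁ := hh φ₁ ⟨hφ₁s, Set.support_indicator_subset.trans hWV⟩
  rw [energy] at hpos ⊢
  rw [energy]
  linarith

end WeightedGraph

/-! ### The decay theorem -/

theorem mainTheorem2 {X : Type*} [Countable X] [Infinite X] (G : WeightedGraph X)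
    (hX : G.ConnectedOn Set.univ) (p : ℝ) (hp : 1 < p) (c m : X → ℝ)
    (V : Set X) (hm : ∀ x ∈ V, 0 < m x) (hV : G.ConnectedOn V) (hVne : V.Nonempty)
    (hh : G.EnergyNonneg p c V) :
    (∀ (W : Set X) (u : X → ℝ), W ⊆ V → W.Nonempty →
      G.IsCritical p c V →
      G.IsAgmonGroundState p c m V u →
      u ∈ WeightedGraph.weightedLp p (V \ W) (G.degOn W) →
      (∃ C : ℝ, ∀ x ∈ W, ∀ y ∈ V \ W, G.Adj x y → u x / u y ≤ C) →
      ∀ w : X → ℝ, G.IsHardyWeight p c (V \ W) w →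
        w ∈ WeightedGraph.weightedLp 1 (V \ W) (fun x => u x ^ p) ∧
        u ∈ WeightedGraph.weightedLp p (V \ W) w) ∧
    (∀ (K : Set X) (v : X → ℝ), K ⊆ V → K.Finite → K.Nonempty →
      G.IsSubcritical p c V →
      {e : X × X | e.1 ∈ K ∧ e.2 ∈ V \ K ∧ G.Adj e.1 e.2}.Finite →
      v ∈ G.minimalGrowth p c m V K →
      ∀ w : X → ℝ, G.IsHardyWeight p c V w →
        w ∈ WeightedGraph.weightedLp 1 V (fun x => v x ^ p)) := by
  have hl1 : ∀ (U : Set X) (u w : X → ℝ), (∀ x, 0 ≤ u x) → (∀ x ∈ U, 0 ≤ w x) →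
      Summable (fun x : U => |u x| ^ p * w x) →
      w ∈ WeightedGraph.weightedLp 1 U (fun x => u x ^ p) := fun U u w hu hw hs =>
    hs.congr fun x => by
      rw [Real.rpow_one, abs_of_nonneg (hw x x.2), abs_of_nonneg (hu x), mul_comm]
  refine ⟨?_, ?_⟩
  · rintro W u hWV - - ⟨hu, -⟩ hdeg ⟨C, hC⟩ w ⟨hw0, -, hw⟩
    obtain ⟨o, ho⟩ := hVne
    -- Here `K = ∅`, and a single point serves as the comparison set.
    have hoc : G.ConnectedOn {o} := by rintro x rfl y rfl; exact .refl
    obtain ⟨F, φ, B, hφ, h0, hle, hB, hlim⟩ := G.exists_tendsto_of_mem_minimalGrowth hp hm hV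
      (Set.empty_subset _) (Set.singleton_subset_iff.2 ho) (Set.finite_singleton o)
      (Set.singleton_nonempty o) hoc hu
    obtain ⟨B', hB'⟩ := G.energy_indicator_diff_le hp hWV hh hu.1.1 hu.1.2 hdeg hC
    have hcc : ∀ i, WeightedGraph.IsCc (V \ W) ((V \ W).indicator (φ i)) := fun i =>
      ⟨(hφ i).1.subset (Set.support_indicator.trans_subset Set.inter_subset_right),
        Set.support_indicator_subset⟩
    have hs : Summable (fun x : ↥(V \ W) => |u x| ^ p * w x) :=
      WeightedGraph.summable_rpow_mul_of_weightFunctional_le hp hw0 (F := (F : Filter _))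
        hcc (B := B + B')
        (fun i => (hw _ (hcc i)).trans ((hB' (φ i) (hφ i) (h0 i) (hle i)).trans
          (by linarith [hB i])))
        fun x hx => by simpa only [Set.indicator_of_mem hx] using hlim x hx.1
    exact ⟨hl1 _ u w hu.1.1 hw0 hs, hs⟩
  · rintro K v hKV hKf hKn - - hv w ⟨hw0, -, hw⟩
    obtain ⟨K', hK'f, hKK', hK'V, hK'c⟩ := G.exists_finite_connectedOn hV hKV hKf hKn
    obtain ⟨F, φ, B, hφ, h0, hle, hB, hlim⟩ := G.exists_tendsto_of_mem_minimalGrowth hp hm hV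
      hKK' hK'V hK'f (hKn.mono hKK') hK'c hv
    exact hl1 V v w hv.1.1 hw0 (WeightedGraph.summable_rpow_mul_of_weightFunctional_le hp hw0
      (F := (F : Filter _)) hφ (fun i => (hw _ (hφ i)).trans (hB i)) hlim)
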